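/- Let $\mathfrak B$ be a real or complex Banach space, $[\mathfrak B]$ the Banach algebra of bounded linear operators on $\mathfrak B$, and let $A\in C(\mathbb R,[\mathfrak B])$, $f\in C(\mathbb R,\mathfrak B)$. Spaces $C(\mathbb R,X)$ carry the topology of uniform convergence on bounded intervals, and $\varphi^{h}(t):=\varphi(t+h)$. Let $U(t)$ be the Cauchy operator of $x'=A(t)x$, that is, $U'(t)=A(t)U(t)$ and $U(0)=I$. For $\varphi\in C(\mathbb R,X)$ let $\mathfrak L_\varphi$ be the set of all real sequences $(t_n)$ such that $t_n\to+\infty$ or $t_n\to-\infty$, and $(\varphi^{t_n})$ converges in $C(\mathbb R,X)$. A solution $\varphi$ on $\mathbb R$ of $$x'=A(t)x+f(t)\qquad(1)$$ is called *two-sided remotely compatible* if $\mathfrak L_{(A,f)}\subseteq\mathfrak L_\varphi$. Assume that 1. $(A,f)$ is Lagrange stable, i.e. $\{(A^h,f^h) : h\in\mathbb R\}$ is precompact in $C(\mathbb R,[\mathfrak B]\times\mathfrak B)$; 2. $x'=A(t)x$ has an exponential trichotomy on $\mathbb R$ with bounded projections $P,Q$, i.e. $P^2=P$, $Q^2=Q$,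 $PQ=QP$, $P+Q-PQ=I$, and there are constants $\mathcal N\ge 1$, $\nu>0$ with $$\begin{aligned} \|U(t)PU^{-1}(\tau)\|&\le \mathcal N e^{-\nu(t-\tau)} && (0\le\tau\le t),\\ \|U(t)(I-P)U^{-1}(\tau)\|&\le \mathcal N e^{-\nu(\tau-t)} && (t\le\tau,\ \tau\ge0),\\ \|U(t)QU^{-1}(\tau)\|&\le \mathcal N e^{-\nu(\tau-t)} && (t\le\tau\le0),\\ \|U(t)(I-Q)U^{-1}(\tau)\|&\le \mathcal N e^{-\nu(t-\tau)} && (\tau\le t,\ \tau\le0); \end{aligned}$$ 3. $x'=A(t)x$ has an exponential dichotomy on $\mathbb R$, i.e. there are a bounded projection $P_0$ and constants $\mathcal N_0\ge1$, $\nu_0>0$ with $\|U(t)P_0U^{-1}(\tau)\|\le\mathcal N_0e^{-\nu_0(t-\tau)}$ for all $t>\tau$ and $\|U(t)(I-P_0)U^{-1}(\tau)\|\le\mathcal N_0e^{\nu_0(t-\tau)}$ for all $t<\tau$. (If 3 holds, then 2 holds with $P=P_0$ and $Q=I-P_0$.) Then equation (1) has a unique two-sided remotely compatible solution $\varphi$,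 and for every $t\in\mathbb R$ $$\varphi(t)=\int_{-\infty}^{+\infty}G(t,\tau)f(\tau)\,d\tau,$$ where the integral converges absolutely and $G$ is the Green function $$G(t,\tau)=\begin{cases}U(t)PU^{-1}(\tau), & 0\le\tau<t,\\ -U(t)(I-P)U^{-1}(\tau), & t\le\tau,\ \tau\ge0,\\ -U(t)QU^{-1}(\tau), & t\le\tau\le0,\\ U(t)(I-Q)U^{-1}(\tau), & \tau\le t,\ \tau\le0\end{cases}$$ (where the cases overlap, take the first that applies; this does not affect the integral). -/

import Mathlib

open Filter Topology MeasureTheory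

noncomputable section

/-! ### Existence and uniqueness for linear differential equations, the Cauchy operator -/

/-- Picard iterates of the linear equation `x' = L(t) x`, `x(0) = x₀` (increments). -/
def picardTerm {F : Type*} [NormedAddCommGroup F] [NormedSpace ℝ F]
    (L : ℝ → F →L[ℝ] F) (x₀ : F) : ℕ → ℝ → F
  | 0 => fun _ => x₀
  | n + 1 => fun t => ∫ s in (0 : ℝ)..t, L s (picardTerm L x₀ n s)

theorem continuous_picardTerm {F : Type*} [NormedAddCommGroup F] [NormedSpace ℝ F]
    [CompleteSpace F] {L : ℝ → F →L[ℝ] F} (hL : Continuous L) (x₀ : F) (n : ℕ) :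
    Continuous (picardTerm L x₀ n) := by
  induction n with
  | zero => exact continuous_const
  | succ n ih =>
    have h : Continuous fun s => L s (picardTerm L x₀ n s) := hL.clm_apply ih
    exact intervalIntegral.continuous_primitive (fun a b => h.intervalIntegrable a b) 0

theorem hasDerivAt_picardTerm_succ {F : Type*} [NormedAddCommGroup F] [NormedSpace ℝ F]
    [CompleteSpace F] {L : ℝ → F →L[ℝ] F} (hL : Continuous L) (x₀ : F) (n : ℕ) (t : ℝ) :
    HasDerivAt (picardTerm L x₀ (n + 1)) (L t (picardTerm L x₀ n t)) t := by
  have h : Continuous fun s => L s (picardTerm L x₀ n s) :=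
    hL.clm_apply (continuous_picardTerm hL x₀ n)
  exact intervalIntegral.integral_hasDerivAt_right (h.intervalIntegrable 0 t)
    h.stronglyMeasurable.stronglyMeasurableAtFilter h.continuousAt

theorem norm_picardTerm_le {F : Type*} [NormedAddCommGroup F] [NormedSpace ℝ F]
    [CompleteSpace F] {L : ℝ → F →L[ℝ] F} (hL : Continuous L) (x₀ : F) {M T : ℝ}
    (hM : ∀ s : ℝ, |s| ≤ T → ‖L s‖ ≤ M) (n : ℕ) :
    ∀ t : ℝ, |t| ≤ T → ‖picardTerm L x₀ n t‖ ≤ ‖x₀‖ * (M ^ n * |t| ^ n / n.factorial) := by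
  induction n with
  | zero => intro t _; simp [picardTerm]
  | succ n ih =>
    intro t ht
    have hM0 : 0 ≤ M := (norm_nonneg _).trans (hM t ht)
    have hc : Continuous fun s => L s (picardTerm L x₀ n s) :=
      hL.clm_apply (continuous_picardTerm hL x₀ n)
    have hmem : ∀ s ∈ Set.uIoc 0 t, |s| ≤ T := by
      intro s hs
      refine le_trans ?_ ht
      rcases le_total 0 t with h | h
      · rw [Set.uIoc_of_le h] at hs
        rw [abs_of_pos hs.1, abs_of_nonneg h]; exact hs.2
      · rw [Set.uIoc_of_ge h] at hs
        rw [abs_of_nonpos hs.2, abs_of_nonpos h]; linarith [hs.1]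
    calc ‖picardTerm L x₀ (n + 1) t‖
        ≤ ∫ s in Set.uIoc 0 t, ‖L s (picardTerm L x₀ n s)‖ :=
          intervalIntegral.norm_integral_le_integral_norm_uIoc
      _ ≤ ∫ s in Set.uIoc 0 t, (‖x₀‖ * M ^ (n + 1) / n.factorial) * |s - 0| ^ n := by
          refine setIntegral_mono_on ?_ ?_ measurableSet_uIoc ?_
          · exact (hc.norm.integrableOn_Icc (a := min 0 t) (b := max 0 t)).mono_set
              Set.Ioc_subset_Icc_self
          · have : Continuous fun s : ℝ => (‖x₀‖ * M ^ (n + 1) / n.factorial) * |s - 0| ^ n := by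
              fun_prop
            exact (this.integrableOn_Icc (a := min 0 t) (b := max 0 t)).mono_set
              Set.Ioc_subset_Icc_self
          · intro s hs
            have h1 := hM s (hmem s hs)
            have h2 := ih s (hmem s hs)
            calc ‖L s (picardTerm L x₀ n s)‖ ≤ ‖L s‖ * ‖picardTerm L x₀ n s‖ :=
                  (L s).le_opNorm _
              _ ≤ M * (‖x₀‖ * (M ^ n * |s| ^ n / n.factorial)) := by gcongr
              _ = _ := by rw [sub_zero]; ring
      _ = _ := by
          rw [integral_const_mul, integral_pow_abs_sub_uIoc, sub_zero, Nat.factorial_succ]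
          push_cast
          field_simp

theorem exists_linearODE_solution {F : Type*} [NormedAddCommGroup F] [NormedSpace ℝ F]
    [CompleteSpace F] {L : ℝ → F →L[ℝ] F} (hL : Continuous L) (x₀ : F) :
    ∃ x : ℝ → F, x 0 = x₀ ∧ ∀ t, HasDerivAt x (L t (x t)) t := by
  have key : ∀ T : ℝ, ∃ M : ℝ, ∀ s : ℝ, |s| ≤ T → ‖L s‖ ≤ M := by
    intro T
    obtain ⟨M, hM⟩ := (isCompact_Icc (a := -T) (b := T)).exists_bound_of_continuousOn
      hL.continuousOn
    exact ⟨M, fun s hs => hM s (abs_le.mp hs)⟩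
  have hsum0 : ∀ M T : ℝ, Summable fun n : ℕ => ‖x₀‖ * (M ^ n * T ^ n / n.factorial) := by
    intro M T
    simpa only [← mul_pow] using (Real.summable_pow_div_factorial (M * T)).mul_left ‖x₀‖
  have hsum : ∀ t : ℝ, Summable fun n => picardTerm L x₀ n t := by
    intro t
    obtain ⟨M, hM⟩ := key |t|
    exact Summable.of_norm_bounded (hsum0 M |t|)
      (fun n => norm_picardTerm_le hL x₀ hM n t le_rfl)
  refine ⟨fun t => ∑' n, picardTerm L x₀ n t, ?_, fun t => ?_⟩
  · change ∑' n, picardTerm L x₀ n 0 = x₀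
    rw [tsum_eq_single 0]
    · rfl
    · intro n hn
      obtain ⟨m, rfl⟩ := Nat.exists_eq_succ_of_ne_zero hn
      simp [picardTerm]
  · set T : ℝ := |t| + 1 with hT
    have hT0 : 0 < T := by positivity
    obtain ⟨M, hM⟩ := key T
    have hM0 : 0 ≤ M := (norm_nonneg _).trans (hM 0 (by simpa using hT0.le))
    let g' : ℕ → ℝ → F := fun n =>
      match n with
      | 0 => fun _ => 0
      | m + 1 => fun s => L s (picardTerm L x₀ m s)
    let u : ℕ → ℝ := fun n =>
      match n with
      | 0 => 0
      | m + 1 => M * (‖x₀‖ * (M ^ m * T ^ m / m.factorial))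
    have hu : Summable u := (summable_nat_add_iff 1).mp ((hsum0 M T).mul_left M)
    have hmem : t ∈ Set.Ioo (-T) T := abs_lt.mp (by rw [hT]; linarith)
    have h := hasDerivAt_tsum_of_isPreconnected (g := picardTerm L x₀) (g' := g') (y₀ := t)
      (y := t) hu isOpen_Ioo isPreconnected_Ioo ?_ ?_ hmem (hsum t) hmem
    · have e : ∑' n, g' n t = L t (∑' n, picardTerm L x₀ n t) := by
        have hs : Summable fun n => g' n t :=
          (summable_nat_add_iff 1).mp ((L t).summable (hsum t))
        rw [hs.tsum_eq_zero_add, (L t).map_tsum (hsum t)]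
        simp [g']
      rw [e] at h
      exact h
    · intro n y _
      cases n with
      | zero => exact hasDerivAt_const y x₀
      | succ m => exact hasDerivAt_picardTerm_succ hL x₀ m y
    · intro n y hy
      have hy' : |y| ≤ T := (abs_lt.mpr hy).le
      cases n with
      | zero => simp [g', u]
      | succ m =>
        change ‖L y (picardTerm L x₀ m y)‖ ≤ M * (‖x₀‖ * (M ^ m * T ^ m / m.factorial))
        calc ‖L y (picardTerm L x₀ m y)‖ ≤ ‖L y‖ * ‖picardTerm L x₀ m y‖ := (L y).le_opNorm _
          _ ≤ M * (‖x₀‖ * (M ^ m * |y| ^ m / m.factorial)) := by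
            have := norm_picardTerm_le hL x₀ hM m y hy'
            have := hM y hy'
            gcongr
          _ ≤ _ := by gcongr

theorem linearODE_solution_unique {F : Type*} [NormedAddCommGroup F] [NormedSpace ℝ F]
    {L : ℝ → F →L[ℝ] F} (hL : Continuous L) {x y : ℝ → F}
    (hx : ∀ t, HasDerivAt x (L t (x t)) t) (hy : ∀ t, HasDerivAt y (L t (y t)) t)
    (h0 : x 0 = y 0) : x = y := by
  funext t
  obtain ⟨M, hM⟩ := (isCompact_Icc (a := -(|t| + 1)) (b := |t| + 1)).exists_bound_of_continuousOn
    hL.continuousOn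
  have h := ODE_solution_unique_of_mem_Ioo (v := fun s z => L s z) (s := fun _ => Set.univ)
    (K := M.toNNReal) (f := x) (g := y) (a := -(|t| + 1)) (b := |t| + 1) (t₀ := 0) ?_ ?_
    (fun s _ => ⟨hx s, trivial⟩) (fun s _ => ⟨hy s, trivial⟩) h0
  · exact h (abs_lt.mp (by linarith))
  · intro s hs
    refine ((L s).lipschitz.weaken ?_).lipschitzOnWith
    have := hM s (Set.Ioo_subset_Icc_self hs)
    rw [← NNReal.coe_le_coe]
    exact this.trans (Real.le_coe_toNNReal M)
  · constructor <;> nlinarith [abs_nonneg t]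

theorem exists_cauchy_units {E : Type*} [NormedRing E] [NormedAlgebra ℝ E] [CompleteSpace E]
    {a : ℝ → E} (ha : Continuous a) :
    ∃ U : ℝ → Eˣ, U 0 = 1 ∧ ∀ t, HasDerivAt (fun s => (U s : E)) (a t * (U t : E)) t := by
  have hl : Continuous fun t => ContinuousLinearMap.mul ℝ E (a t) :=
    (ContinuousLinearMap.mul ℝ E).continuous.comp ha
  have hr : Continuous fun t => (ContinuousLinearMap.mul ℝ E).flip (-a t) :=
    (ContinuousLinearMap.mul ℝ E).flip.continuous.comp ha.neg
  obtain ⟨u, hu0, hu⟩ := exists_linearODE_solution hl (1 : E)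
  obtain ⟨v, hv0, hv⟩ := exists_linearODE_solution hr (1 : E)
  replace hu : ∀ t, HasDerivAt u (a t * u t) t := hu
  replace hv : ∀ t, HasDerivAt v (v t * (-a t)) t := hv
  have hvu : ∀ t, v t * u t = 1 := by
    have hd : ∀ t, HasDerivAt (fun s => v s * u s) 0 t := fun t => by
      have := (hv t).mul (hu t)
      have e : v t * -a t * u t + v t * (a t * u t) = 0 := by noncomm_ring
      rw [e] at this
      exact this
    intro t
    have := is_const_of_deriv_eq_zero (fun t => (hd t).differentiableAt)
      (fun t => (hd t).deriv) t 0
    simpa [hu0, hv0] using this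
  have huv : (fun t => u t * v t) = fun _ => 1 := by
    have hc : Continuous fun t =>
        ContinuousLinearMap.mul ℝ E (a t) - (ContinuousLinearMap.mul ℝ E).flip (a t) :=
      hl.sub ((ContinuousLinearMap.mul ℝ E).flip.continuous.comp ha)
    refine linearODE_solution_unique hc (fun t => ?_) (fun t => ?_) (by simp [hu0, hv0])
    · have := (hu t).mul (hv t)
      have e : a t * u t * v t + u t * (v t * -a t)
          = a t * (u t * v t) - (u t * v t) * a t := by noncomm_ring
      rw [e] at this
      exact this
    · simpa using hasDerivAt_const t (1 : E)
  refine ⟨fun t => ⟨u t, v t, congrFun huv t, hvu t⟩, ?_, hu⟩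
  ext
  exact hu0

/-- A continuous family `A` of bounded operators has an everywhere invertible Cauchy operator. -/
theorem exists_cauchyOperator {𝕜 : Type*} [RCLike 𝕜] {𝔅 : Type*} [NormedAddCommGroup 𝔅]
    [NormedSpace ℝ 𝔅] [NormedSpace 𝕜 𝔅] [IsScalarTower ℝ 𝕜 𝔅] [CompleteSpace 𝔅]
    (A : C(ℝ, 𝔅 →L[𝕜] 𝔅)) :
    ∃ U : ℝ → (𝔅 →L[𝕜] 𝔅)ˣ, U 0 = 1 ∧
      ∀ t, HasDerivAt (fun s => (U s : 𝔅 →L[𝕜] 𝔅)) (A t * (U t : 𝔅 →L[𝕜] 𝔅)) t := by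
  let _ : NormedAlgebra ℝ (𝔅 →L[𝕜] 𝔅) :=
    { Algebra.ofModule (fun r x y => by ext; simp) (fun r x y => by
        ext z
        change x (r • y z) = r • x (y z)
        rw [← algebraMap_smul 𝕜 r (y z), ← algebraMap_smul 𝕜 r (x (y z)), map_smul]) with
      norm_smul_le := fun r x => norm_smul_le r x }
  exact exists_cauchy_units A.continuous

/-- The Cauchy operator `U(t, A)` of `x' = A(t) x`: the solution of `U' = A(t) U`, `U(0) = 1`
in the algebra of bounded operators, with values in the invertible operators. -/
def cauchyOperator {𝕜 : Type*} [RCLike 𝕜] {𝔅 : Type*} [NormedAddCommGroup 𝔅]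
    [NormedSpace ℝ 𝔅] [NormedSpace 𝕜 𝔅] [IsScalarTower ℝ 𝕜 𝔅] [CompleteSpace 𝔅]
    (A : C(ℝ, 𝔅 →L[𝕜] 𝔅)) : ℝ → (𝔅 →L[𝕜] 𝔅)ˣ :=
  Classical.choose (exists_cauchyOperator A)

theorem cauchyOperator_spec {𝕜 : Type*} [RCLike 𝕜] {𝔅 : Type*} [NormedAddCommGroup 𝔅]
    [NormedSpace ℝ 𝔅] [NormedSpace 𝕜 𝔅] [IsScalarTower ℝ 𝕜 𝔅] [CompleteSpace 𝔅]
    (A : C(ℝ, 𝔅 →L[𝕜] 𝔅)) :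
    cauchyOperator A 0 = 1 ∧ ∀ t, HasDerivAt (fun s => (cauchyOperator A s : 𝔅 →L[𝕜] 𝔅))
      (A t * (cauchyOperator A t : 𝔅 →L[𝕜] 𝔅)) t :=
  Classical.choose_spec (exists_cauchyOperator A)

/-- The bounded operator `U(t, A) S U(τ, A)⁻¹`. -/
def propagate {𝕜 : Type*} [RCLike 𝕜] {𝔅 : Type*} [NormedAddCommGroup 𝔅]
    [NormedSpace ℝ 𝔅] [NormedSpace 𝕜 𝔅] [IsScalarTower ℝ 𝕜 𝔅] [CompleteSpace 𝔅]
    (A : C(ℝ, 𝔅 →L[𝕜] 𝔅)) (S : 𝔅 →L[𝕜] 𝔅) (t τ : ℝ) : 𝔅 →L[𝕜] 𝔅 :=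
  (cauchyOperator A t : 𝔅 →L[𝕜] 𝔅) * S * ((cauchyOperator A τ)⁻¹ : (𝔅 →L[𝕜] 𝔅)ˣ)

/-! ### Exponential dichotomy, exponential trichotomy, the Green function -/

/-- The equation `x' = A(t) x` has an exponential dichotomy on `I ⊆ ℝ`: there are a bounded
projection `P` and constants `N ≥ 1`, `ν > 0` with the two exponential estimates. -/
def HasExponentialDichotomyOn {𝕜 : Type*} [RCLike 𝕜] {𝔅 : Type*} [NormedAddCommGroup 𝔅]
    [NormedSpace ℝ 𝔅] [NormedSpace 𝕜 𝔅] [IsScalarTower ℝ 𝕜 𝔅] [CompleteSpace 𝔅]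
    (A : C(ℝ, 𝔅 →L[𝕜] 𝔅)) (I : Set ℝ) : Prop :=
  ∃ P : 𝔅 →L[𝕜] 𝔅, P * P = P ∧ ∃ N ν : ℝ, 1 ≤ N ∧ 0 < ν ∧
    (∀ t ∈ I, ∀ τ ∈ I, τ < t → ‖propagate A P t τ‖ ≤ N * Real.exp (-ν * (t - τ))) ∧
    (∀ t ∈ I, ∀ τ ∈ I, t < τ → ‖propagate A (1 - P) t τ‖ ≤ N * Real.exp (ν * (t - τ)))

/-- The equation `x' = A(t) x` has an exponential trichotomy on `ℝ` with the bounded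
projections `P` and `Q`. -/
def HasExponentialTrichotomy {𝕜 : Type*} [RCLike 𝕜] {𝔅 : Type*} [NormedAddCommGroup 𝔅]
    [NormedSpace ℝ 𝔅] [NormedSpace 𝕜 𝔅] [IsScalarTower ℝ 𝕜 𝔅] [CompleteSpace 𝔅]
    (A : C(ℝ, 𝔅 →L[𝕜] 𝔅)) (P Q : 𝔅 →L[𝕜] 𝔅) : Prop :=
  P * P = P ∧ Q * Q = Q ∧ P * Q = Q * P ∧ P + Q - P * Q = 1 ∧
  ∃ N ν : ℝ, 1 ≤ N ∧ 0 < ν ∧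
    (∀ t τ : ℝ, 0 ≤ τ → τ ≤ t → ‖propagate A P t τ‖ ≤ N * Real.exp (-ν * (t - τ))) ∧
    (∀ t τ : ℝ, t ≤ τ → 0 ≤ τ → ‖propagate A (1 - P) t τ‖ ≤ N * Real.exp (-ν * (τ - t))) ∧
    (∀ t τ : ℝ, t ≤ τ → τ ≤ 0 → ‖propagate A Q t τ‖ ≤ N * Real.exp (-ν * (τ - t))) ∧
    (∀ t τ : ℝ, τ ≤ t → τ ≤ 0 → ‖propagate A (1 - Q) t τ‖ ≤ N * Real.exp (-ν * (t - τ)))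

/-- The Green function of an exponential trichotomy with projections `P`, `Q`. The usual
case distinction overlaps for `t = τ` and for `τ = 0`; there the first applicable line is
taken, which does not affect integrals in `τ`. -/
def greenFunction {𝕜 : Type*} [RCLike 𝕜] {𝔅 : Type*} [NormedAddCommGroup 𝔅]
    [NormedSpace ℝ 𝔅] [NormedSpace 𝕜 𝔅] [IsScalarTower ℝ 𝕜 𝔅] [CompleteSpace 𝔅]
    (A : C(ℝ, 𝔅 →L[𝕜] 𝔅)) (P Q : 𝔅 →L[𝕜] 𝔅) (t τ : ℝ) : 𝔅 →L[𝕜] 𝔅 :=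
  if 0 ≤ τ ∧ τ < t then propagate A P t τ
  else if t ≤ τ ∧ 0 ≤ τ then -propagate A (1 - P) t τ
  else if t ≤ τ ∧ τ ≤ 0 then -propagate A Q t τ
  else propagate A (1 - Q) t τ

/-! ### Shifts, Lagrange stability, remote compatibility -/

/-- The translate `φ^h(t) = φ(t + h)`. The space `C(ℝ, X)` carries the compact-open topology,
i.e. the topology of uniform convergence on bounded intervals. -/
def shiftMap {X : Type*} [TopologicalSpace X] (h : ℝ) (φ : C(ℝ, X)) : C(ℝ, X) :=
  φ.comp (ContinuousMap.addRight h)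

/-- `φ` is Lagrange stable: its set of translates is precompact in `C(ℝ, X)`. -/
def IsLagrangeStable {X : Type*} [TopologicalSpace X] (φ : C(ℝ, X)) : Prop :=
  IsCompact (closure (Set.range fun h : ℝ => shiftMap h φ))

/-- The sequences `tₙ → +∞` along which the translates of `φ` converge in `C(ℝ, X)`. -/
def posRemoteSeqs {X : Type*} [TopologicalSpace X] (φ : C(ℝ, X)) : Set (ℕ → ℝ) :=
  {s | Tendsto s atTop atTop ∧
    ∃ ψ : C(ℝ, X), Tendsto (fun n => shiftMap (s n) φ) atTop (𝓝 ψ)}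

/-- The sequences `tₙ → -∞` along which the translates of `φ` converge in `C(ℝ, X)`. -/
def negRemoteSeqs {X : Type*} [TopologicalSpace X] (φ : C(ℝ, X)) : Set (ℕ → ℝ) :=
  {s | Tendsto s atTop atBot ∧
    ∃ ψ : C(ℝ, X), Tendsto (fun n => shiftMap (s n) φ) atTop (𝓝 ψ)}

/-- The set `𝔏_φ` of all sequences going to `+∞` or to `-∞` along which the translates
converge. -/
def remoteSeqs {X : Type*} [TopologicalSpace X] (φ : C(ℝ, X)) : Set (ℕ → ℝ) :=
  negRemoteSeqs φ ∪ posRemoteSeqs φ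

/-- `φ` is a solution on `ℝ` of `x' = A(t) x + f(t)`. -/
def IsSolution {𝕜 : Type*} [RCLike 𝕜] {𝔅 : Type*} [NormedAddCommGroup 𝔅]
    [NormedSpace ℝ 𝔅] [NormedSpace 𝕜 𝔅]
    (A : C(ℝ, 𝔅 →L[𝕜] 𝔅)) (f φ : C(ℝ, 𝔅)) : Prop :=
  ∀ t : ℝ, HasDerivAt φ (A t (φ t) + f t) t

/-- `φ` is a two-sided remotely compatible solution of `x' = A(t) x + f(t)`. -/
def IsRemotelyCompatibleSolution {𝕜 : Type*} [RCLike 𝕜] {𝔅 : Type*} [NormedAddCommGroup 𝔅]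
    [NormedSpace ℝ 𝔅] [NormedSpace 𝕜 𝔅]
    (A : C(ℝ, 𝔅 →L[𝕜] 𝔅)) (f φ : C(ℝ, 𝔅)) : Prop :=
  IsSolution A f φ ∧ remoteSeqs (A.prodMk f) ⊆ remoteSeqs φ

end

/-! On `ℝ` the dichotomy determines its projection, so the trichotomy must have `P = P₀` and `Q = 1
- P`. The Green kernel then decays like `exp (-ν * |t - τ|)`. Lagrange stability bounds `f`, so the
Green integral converges and is a bounded solution (`exists_bounded_solution`). The rest hinges on
`norm_le_of_bounded_of_propagate_le`: a bounded solution of `w' = A w + r` is small at `t` as soon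
as `r` is small on a long interval around `t`. With `r = 0` it gives uniqueness among bounded
solutions. Applied to the difference of `φ` and a translate of `φ`, it shows that translates of `φ`
form a Cauchy sequence whenever those of `(A, f)` converge. Only the dichotomy of `A` itself enters;
no limit equation is studied. Finally, a remotely compatible solution is bounded: were it to blow up
along a sequence, compactness of the hull of `(A, f)` would supply a remote subsequence along which
its translates converge, a contradiction. -/

theorem hasDerivAt_units_inv {E : Type*} [NormedRing E] [NormedAlgebra ℝ E] [CompleteSpace E]
    {U : ℝ → Eˣ} {a : E} {t : ℝ} (hU : HasDerivAt (fun s => (U s : E)) (a * U t) t) :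
    HasDerivAt (fun s => (((U s)⁻¹ : Eˣ) : E)) (-(((U t)⁻¹ : Eˣ) * a)) t := by
  have h := (hasFDerivAt_ringInverse (𝕜 := ℝ) (U t)).comp_hasDerivAt t hU
  simpa [Function.comp_def, mul_assoc] using h

/-! ### Variation of constants and the central estimate -/

section Propagate

variable {𝕜 : Type*} [RCLike 𝕜] {𝔅 : Type*} [NormedAddCommGroup 𝔅]
  [NormedSpace ℝ 𝔅] [NormedSpace 𝕜 𝔅] [IsScalarTower ℝ 𝕜 𝔅]

/-- Time is real while the operators are `𝕜`-linear, so scalars are restricted to `ℝ` before the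
product rule is used. -/
theorem HasDerivAt.clm_apply_of_isScalarTower {c : ℝ → 𝔅 →L[𝕜] 𝔅} {c' : 𝔅 →L[𝕜] 𝔅}
    {u : ℝ → 𝔅} {u' : 𝔅} {t : ℝ} (hc : HasDerivAt c c' t) (hu : HasDerivAt u u' t) :
    HasDerivAt (fun s => c s (u s)) (c' (u t) + c t u') t := by
  have h := (ContinuousLinearMap.restrictScalarsL 𝕜 𝔅 𝔅 ℝ ℝ).hasFDerivAt.comp_hasDerivAt t hc
  exact h.clm_apply hu

variable [CompleteSpace 𝔅]

theorem hasDerivAt_cauchyOperator_inv (A : C(ℝ, 𝔅 →L[𝕜] 𝔅)) (t : ℝ) :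
    HasDerivAt (fun s => (((cauchyOperator A s)⁻¹ : (𝔅 →L[𝕜] 𝔅)ˣ) : 𝔅 →L[𝕜] 𝔅))
      (-(((cauchyOperator A t)⁻¹ : (𝔅 →L[𝕜] 𝔅)ˣ) * A t)) t := by
  let _ : NormedAlgebra ℝ (𝔅 →L[𝕜] 𝔅) :=
    { Algebra.ofModule (fun r x y => by ext; simp) (fun r x y => by
        ext z
        change x (r • y z) = r • x (y z)
        rw [← algebraMap_smul 𝕜 r (y z), ← algebraMap_smul 𝕜 r (x (y z)), map_smul]) with
      norm_smul_le := fun r x => norm_smul_le r x }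
  exact hasDerivAt_units_inv ((cauchyOperator_spec A).2 t)

theorem continuous_cauchyOperator_inv (A : C(ℝ, 𝔅 →L[𝕜] 𝔅)) :
    Continuous fun s => (((cauchyOperator A s)⁻¹ : (𝔅 →L[𝕜] 𝔅)ˣ) : 𝔅 →L[𝕜] 𝔅) :=
  continuous_iff_continuousAt.2 fun t => (hasDerivAt_cauchyOperator_inv A t).continuousAt

theorem continuous_propagate_apply (A : C(ℝ, 𝔅 →L[𝕜] 𝔅)) (S : 𝔅 →L[𝕜] 𝔅) (t : ℝ)
    {r : ℝ → 𝔅} (hr : Continuous r) : Continuous fun τ => propagate A S t τ (r τ) :=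
  (continuous_const.mul (continuous_cauchyOperator_inv A)).clm_apply hr

theorem propagate_add_propagate_one_sub (A : C(ℝ, 𝔅 →L[𝕜] 𝔅)) (P : 𝔅 →L[𝕜] 𝔅) (t : ℝ) :
    propagate A P t t + propagate A (1 - P) t t = 1 := by
  simp only [propagate]
  rw [← add_mul, ← mul_add, add_sub_cancel, mul_one, Units.mul_inv]

/-- Variation of constants along a component of a solution. -/
theorem propagate_self_eq_add_integral (A : C(ℝ, 𝔅 →L[𝕜] 𝔅)) (S : 𝔅 →L[𝕜] 𝔅) {w r : ℝ → 𝔅}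
    (hr : Continuous r) (hw : ∀ t, HasDerivAt w (A t (w t) + r t) t) (a t : ℝ) :
    propagate A S t t (w t)
      = propagate A S t a (w a) + ∫ τ in a..t, propagate A S t τ (r τ) := by
  -- The term `-U⁻¹ A w` from differentiating `U⁻¹` cancels `U⁻¹ A w` from `w'`; only `r` survives.
  have hd : ∀ τ, HasDerivAt (fun τ => propagate A S t τ (w τ)) (propagate A S t τ (r τ)) τ := by
    intro τ
    have h := ((cauchyOperator A t : 𝔅 →L[𝕜] 𝔅) * S).hasFDerivAt (x :=
      ((cauchyOperator A τ)⁻¹ : (𝔅 →L[𝕜] 𝔅)ˣ).1 (w τ)) |>.restrictScalars ℝ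
      |>.comp_hasDerivAt τ
      ((hasDerivAt_cauchyOperator_inv A τ).clm_apply_of_isScalarTower (hw τ))
    refine h.congr_deriv ?_
    simp [propagate]
  rw [intervalIntegral.integral_eq_sub_of_hasDerivAt (fun τ _ => hd τ)
    ((continuous_propagate_apply A S t hr).intervalIntegrable _ _)]
  abel

/-- A bounded solution of `w' = A(t) w + r(t)` is small at the centre of a long interval on
which `r` is small. -/
theorem norm_le_of_bounded_of_propagate_le {A : C(ℝ, 𝔅 →L[𝕜] 𝔅)} {P : 𝔅 →L[𝕜] 𝔅} {N ν : ℝ}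
    (hN : 0 ≤ N) (hν : 0 < ν)
    (hs : ∀ t τ : ℝ, τ ≤ t → ‖propagate A P t τ‖ ≤ N * Real.exp (-ν * (t - τ)))
    (hu : ∀ t τ : ℝ, t ≤ τ → ‖propagate A (1 - P) t τ‖ ≤ N * Real.exp (-ν * (τ - t)))
    {w r : ℝ → 𝔅} (hr : Continuous r) (hw : ∀ t, HasDerivAt w (A t (w t) + r t) t)
    {W : ℝ} (hW : ∀ t, ‖w t‖ ≤ W) {L ε : ℝ} (hL : 0 ≤ L) {t : ℝ}
    (hε : ∀ τ ∈ Set.Icc (t - L) (t + L), ‖r τ‖ ≤ ε) :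
    ‖w t‖ ≤ 2 * N * (W * Real.exp (-ν * L) + L * ε) := by
  -- Each component starts at the end from which its propagator decays: `t - L` for `P`, `t + L` for
  -- `1 - P`. Under the integral the crude bound `N` suffices, whence the term `L * ε`.
  have key : ∀ (S : 𝔅 →L[𝕜] 𝔅) (a : ℝ), |t - a| = L →
      ‖propagate A S t a‖ ≤ N * Real.exp (-ν * L) →
      (∀ τ ∈ Set.uIoc a t, ‖propagate A S t τ‖ ≤ N) →
      (∀ τ ∈ Set.uIoc a t, ‖r τ‖ ≤ ε) →
      ‖propagate A S t t (w t)‖ ≤ N * (W * Real.exp (-ν * L) + L * ε) := by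
    intro S a ha hSa hS hr'
    rw [propagate_self_eq_add_integral A S hr hw a t]
    have h1 : ‖propagate A S t a (w a)‖ ≤ N * Real.exp (-ν * L) * W :=
      (propagate A S t a).le_of_opNorm_le_of_le hSa (hW a)
    have h2 := intervalIntegral.norm_integral_le_of_norm_le_const
      (f := fun τ => propagate A S t τ (r τ)) (C := N * ε) (a := a) (b := t)
      fun τ hτ => (propagate A S t τ).le_of_opNorm_le_of_le (hS τ hτ) (hr' τ hτ)
    rw [ha] at h2
    calc _ ≤ _ := norm_add_le _ _
      _ ≤ N * Real.exp (-ν * L) * W + N * ε * L := add_le_add h1 h2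
      _ = _ := by ring
  have hexp : ∀ x : ℝ, 0 ≤ x → N * Real.exp (-ν * x) ≤ N := fun x hx =>
    mul_le_of_le_one_right hN (Real.exp_le_one_iff.2 (by nlinarith))
  have h1 := key P (t - L) (by rw [sub_sub_cancel, abs_of_nonneg hL])
    (by simpa using hs t (t - L) (by linarith))
    (fun τ hτ => by
      rw [Set.uIoc_of_le (by linarith)] at hτ
      exact (hs t τ hτ.2).trans (hexp _ (by linarith [hτ.2])))
    (fun τ hτ => by
      rw [Set.uIoc_of_le (by linarith)] at hτ
      exact hε τ ⟨hτ.1.le, by linarith [hτ.2]⟩)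
  have h2 := key (1 - P) (t + L) (by rw [sub_add_cancel_left, abs_neg, abs_of_nonneg hL])
    (by simpa using hu t (t + L) (by linarith))
    (fun τ hτ => by
      rw [Set.uIoc_of_ge (by linarith)] at hτ
      exact (hu t τ hτ.1.le).trans (hexp _ (by linarith [hτ.1])))
    (fun τ hτ => by
      rw [Set.uIoc_of_ge (by linarith)] at hτ
      exact hε τ ⟨by linarith [hτ.1], hτ.2⟩)
  have h3 : w t = propagate A P t t (w t) + propagate A (1 - P) t t (w t) := by
    rw [← add_apply, propagate_add_propagate_one_sub]
    rfl
  rw [h3]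
  calc _ ≤ _ := norm_add_le _ _
    _ ≤ _ := add_le_add h1 h2
    _ = _ := by ring

/-! ### Comparison of the projections -/

/-- Insert `U⁻¹ U` at time `c t` between `X` and `Y`: both factors decay as `t → ∞`. The path `c` is
`t` or `-t`, so that both ends of the line are covered. -/
theorem mul_eq_zero_of_propagate_le {A : C(ℝ, 𝔅 →L[𝕜] 𝔅)} {X Y : 𝔅 →L[𝕜] 𝔅} {M N μ ν : ℝ}
    (hM : 0 ≤ M) (hμ : 0 < μ) (hν : 0 < ν) (c : ℝ → ℝ)
    (hX : ∀ t, 0 < t → ‖propagate A X 0 (c t)‖ ≤ M * Real.exp (-μ * t))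
    (hY : ∀ t, 0 < t → ‖propagate A Y (c t) 0‖ ≤ N * Real.exp (-ν * t)) : X * Y = 0 := by
  have hle : ∀ t, 0 < t → ‖X * Y‖ ≤ M * Real.exp (-μ * t) * (N * Real.exp (-ν * t)) := by
    intro t ht
    have e : X * Y = propagate A X 0 (c t) * propagate A Y (c t) 0 := by
      simp only [propagate, (cauchyOperator_spec A).1, inv_one, Units.val_one, one_mul, mul_one,
        mul_assoc, Units.inv_mul_cancel_left]
    rw [e]
    exact (norm_mul_le _ _).trans
      (mul_le_mul (hX t ht) (hY t ht) (norm_nonneg _) (by positivity))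
  have hexp : ∀ m : ℝ, 0 < m → Tendsto (fun t => Real.exp (-m * t)) atTop (𝓝 0) := fun m hm =>
    Real.tendsto_exp_atBot.comp (tendsto_id.const_mul_atTop_of_neg (neg_lt_zero.2 hm))
  have hlim := ((hexp μ hμ).const_mul M).mul ((hexp ν hν).const_mul N)
  simp only [mul_zero] at hlim
  exact norm_le_zero_iff.1 (ge_of_tendsto hlim ((eventually_gt_atTop 0).mono hle))

/-- The projections of a trichotomy are complementary if there is a dichotomy on `ℝ`; the
trichotomy is then a dichotomy on `ℝ`. -/
theorem HasExponentialTrichotomy.exists_bounds_of_dichotomy {A : C(ℝ, 𝔅 →L[𝕜] 𝔅)}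
    {P Q : 𝔅 →L[𝕜] 𝔅} (hT : HasExponentialTrichotomy A P Q)
    (hD : HasExponentialDichotomyOn A Set.univ) :
    Q = 1 - P ∧ ∃ N ν : ℝ, 0 ≤ N ∧ 0 < ν ∧
      (∀ t τ : ℝ, τ ≤ t → ‖propagate A P t τ‖ ≤ N * Real.exp (-ν * (t - τ))) ∧
      (∀ t τ : ℝ, t ≤ τ → ‖propagate A (1 - P) t τ‖ ≤ N * Real.exp (-ν * (τ - t))) := by
  obtain ⟨-, -, -, -, N, ν, hN, hν, h1, h2, h3, h4⟩ := hT
  obtain ⟨P₀, -, M, μ, hM, hμ, hs, hu⟩ := hD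
  have hM0 : 0 ≤ M := by linarith
  have hs' : ∀ t, 0 < t → ‖propagate A P₀ 0 (-t)‖ ≤ M * Real.exp (-μ * t) := fun t ht => by
    simpa using hs 0 trivial (-t) trivial (by linarith)
  have hu' : ∀ t, 0 < t → ‖propagate A (1 - P₀) 0 t‖ ≤ M * Real.exp (-μ * t) := fun t ht => by
    simpa using hu 0 trivial t trivial ht
  -- `1 - P₀` kills whatever decays at `+∞` (the ranges of `P` and `1 - Q`), and `P₀` kills whatever
  -- decays at `-∞` (the ranges of `1 - P` and `Q`).
  have e1 : (1 - P₀) * P = 0 := mul_eq_zero_of_propagate_le hM0 hμ hν id hu'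
    fun t ht => by simpa using h1 t 0 le_rfl ht.le
  have e2 : P₀ * (1 - P) = 0 := mul_eq_zero_of_propagate_le hM0 hμ hν (fun t => -t) hs'
    fun t ht => by simpa using h2 (-t) 0 (by linarith) le_rfl
  have e3 : P₀ * Q = 0 := mul_eq_zero_of_propagate_le hM0 hμ hν (fun t => -t) hs'
    fun t ht => by simpa using h3 (-t) 0 (by linarith) le_rfl
  have e4 : (1 - P₀) * (1 - Q) = 0 := mul_eq_zero_of_propagate_le hM0 hμ hν id hu'
    fun t ht => by simpa using h4 t 0 ht.le le_rfl
  have hP : P = P₀ := by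
    rw [sub_mul, one_mul, sub_eq_zero] at e1
    rw [mul_sub, mul_one, sub_eq_zero] at e2
    rw [e1, ← e2]
  have hQ : Q = 1 - P := by
    rw [mul_sub, mul_one, sub_mul, one_mul, e3, sub_zero, sub_eq_zero] at e4
    rw [hP, e4]
  refine ⟨hQ, N, ν, by linarith, hν, fun t τ h => ?_, fun t τ h => ?_⟩
  · rcases le_total 0 τ with h0 | h0
    · exact h1 t τ h0 h
    · simpa [hQ] using h4 t τ h h0
  · rcases le_total 0 τ with h0 | h0
    · exact h2 t τ h h0
    · simpa [hQ] using h3 t τ h h0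

end Propagate

/-! ### Exponential kernels; boundedness from Lagrange stability and compatibility -/

theorem integrable_exp_neg_mul_abs {ν : ℝ} (hν : 0 < ν) :
    Integrable fun x : ℝ => Real.exp (-ν * |x|) := by
  rw [← integrableOn_univ, ← Set.Iic_union_Ioi (a := (0 : ℝ)), integrableOn_union]
  constructor
  · refine (integrableOn_exp_mul_Iic hν 0).congr_fun (fun x hx => ?_) measurableSet_Iic
    simp only [abs_of_nonpos (Set.mem_Iic.1 hx), neg_mul_neg]
  · refine (exp_neg_integrableOn_Ioi 0 hν).congr_fun (fun x hx => ?_) measurableSet_Ioi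
    simp only [abs_of_pos (Set.mem_Ioi.1 hx)]

theorem tendsto_exp_neg_mul_atTop {ν : ℝ} (hν : 0 < ν) :
    Tendsto (fun L => Real.exp (-ν * L)) atTop (𝓝 0) :=
  Real.tendsto_exp_atBot.comp (tendsto_id.const_mul_atTop_of_neg (neg_lt_zero.2 hν))

/-- Evaluation at `0` is bounded on the compact hull, and `φ t` is the value at `0` of a translate.
-/
theorem IsLagrangeStable.exists_norm_le {X : Type*} [SeminormedAddCommGroup X] {φ : C(ℝ, X)}
    (h : IsLagrangeStable φ) : ∃ C, ∀ t, ‖φ t‖ ≤ C := by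
  obtain ⟨C, hC⟩ := h.exists_bound_of_continuousOn (f := fun ψ : C(ℝ, X) => ψ 0)
    (continuous_eval_const 0).continuousOn
  refine ⟨C, fun t => ?_⟩
  simpa [shiftMap] using hC _ (subset_closure (Set.mem_range_self t))

/-- Remote sequences must go to one end of the line, whereas `|u n| → ∞` still allows alternating
signs. -/
theorem exists_subseq_tendsto_atBot_or_atTop {u : ℕ → ℝ}
    (hu : Tendsto (fun n => |u n|) atTop atTop) :
    ∃ ρ : ℕ → ℕ, StrictMono ρ ∧
      (Tendsto (u ∘ ρ) atTop atBot ∨ Tendsto (u ∘ ρ) atTop atTop) := by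
  by_cases h : ∃ᶠ n in atTop, 0 ≤ u n
  · obtain ⟨ρ, hρ, h0⟩ := extraction_of_frequently_atTop h
    refine ⟨ρ, hρ, Or.inr ((hu.comp hρ.tendsto_atTop).congr fun n => ?_)⟩
    exact abs_of_nonneg (h0 n)
  · rw [not_frequently] at h
    refine ⟨id, strictMono_id, Or.inl (tendsto_neg_atTop_iff.1 (hu.congr' ?_))⟩
    filter_upwards [h] with n hn
    exact abs_of_neg (not_le.1 hn)

theorem tendsto_abs_atTop_of_lt_norm {X : Type*} [SeminormedAddCommGroup X] {ψ : ℝ → X}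
    (hψ : Continuous ψ) {u : ℕ → ℝ} (hu : ∀ n : ℕ, n < ‖ψ (u n)‖) :
    Tendsto (fun n => |u n|) atTop atTop := by
  refine tendsto_atTop.2 fun b => ?_
  obtain ⟨C, hC⟩ := (isCompact_Icc (a := -b) (b := b)).exists_bound_of_continuousOn
    hψ.continuousOn
  filter_upwards [tendsto_natCast_atTop_atTop.eventually_ge_atTop C] with n hn
  by_contra hb
  exact ((hC _ (abs_le.1 (not_le.1 hb).le)).trans hn).not_gt (hu n)

/-- If every remote sequence of a Lagrange stable function is one of `ψ`, then `ψ` is bounded. -/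
theorem exists_norm_le_of_remoteSeqs_subset {X Y : Type*} [NormedAddCommGroup X]
    [NormedAddCommGroup Y] {ξ : C(ℝ, X)} {ψ : C(ℝ, Y)} (hξ : IsLagrangeStable ξ)
    (h : remoteSeqs ξ ⊆ remoteSeqs ψ) : ∃ W, ∀ t, ‖ψ t‖ ≤ W := by
  by_contra! hW
  choose u hu using fun n : ℕ => hW n
  obtain ⟨ξ', -, σ, hσ, hlim⟩ := hξ.isSeqCompact (x := fun n => shiftMap (u n) ξ)
    fun n => subset_closure (Set.mem_range_self _)
  have habs := (tendsto_abs_atTop_of_lt_norm ψ.continuous hu).comp hσ.tendsto_atTop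
  obtain ⟨ρ, hρ, hinf⟩ := exists_subseq_tendsto_atBot_or_atTop (u := u ∘ σ) habs
  have hlim' := hlim.comp hρ.tendsto_atTop
  have hmem : (u ∘ σ) ∘ ρ ∈ remoteSeqs ξ := by
    rcases hinf with hinf | hinf
    · exact Or.inl ⟨hinf, ξ', hlim'⟩
    · exact Or.inr ⟨hinf, ξ', hlim'⟩
  obtain ⟨ψ', hψ'⟩ : ∃ ψ' : C(ℝ, Y),
      Tendsto (fun n => shiftMap (((u ∘ σ) ∘ ρ) n) ψ) atTop (𝓝 ψ') := by
    rcases h hmem with h | h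
    · exact h.2
    · exact h.2
  -- At `0` the translates take the values of `ψ` along the subsequence: their norms converge, yet
  -- exceed `σ (ρ n)`.
  have h0 := (((continuous_eval_const (0 : ℝ)).tendsto ψ').comp hψ').norm
  refine not_tendsto_nhds_of_tendsto_atTop ?_ _ h0
  refine tendsto_atTop_mono (fun n => ?_)
    (tendsto_natCast_atTop_atTop.comp (hσ.comp hρ).tendsto_atTop)
  simpa [shiftMap] using (hu (σ (ρ n))).le

/-! ### The Green integral as a bounded solution -/

section Solutions

variable {𝕜 : Type*} [RCLike 𝕜] {𝔅 : Type*} [NormedAddCommGroup 𝔅]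
  [NormedSpace ℝ 𝔅] [NormedSpace 𝕜 𝔅] [IsScalarTower ℝ 𝕜 𝔅] [CompleteSpace 𝔅]

/-- For complementary projections the sign of `τ` no longer matters; only the jump at `τ = t`
remains. -/
theorem greenFunction_one_sub (A : C(ℝ, 𝔅 →L[𝕜] 𝔅)) (P : 𝔅 →L[𝕜] 𝔅) (t τ : ℝ) :
    greenFunction A P (1 - P) t τ
      = if τ < t then propagate A P t τ else -propagate A (1 - P) t τ := by
  rw [greenFunction, sub_sub_cancel]
  split_ifs <;> first | rfl | grind

theorem norm_greenFunction_le {A : C(ℝ, 𝔅 →L[𝕜] 𝔅)} {P : 𝔅 →L[𝕜] 𝔅} {N ν : ℝ}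
    (hs : ∀ t τ : ℝ, τ ≤ t → ‖propagate A P t τ‖ ≤ N * Real.exp (-ν * (t - τ)))
    (hu : ∀ t τ : ℝ, t ≤ τ → ‖propagate A (1 - P) t τ‖ ≤ N * Real.exp (-ν * (τ - t)))
    (t τ : ℝ) : ‖greenFunction A P (1 - P) t τ‖ ≤ N * Real.exp (-ν * |t - τ|) := by
  rw [greenFunction_one_sub]
  split_ifs with h
  · rw [abs_of_pos (sub_pos.2 h)]
    exact hs t τ h.le
  · rw [norm_neg, abs_sub_comm, abs_of_nonneg (sub_nonneg.2 (not_lt.1 h))]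
    exact hu t τ (not_lt.1 h)

theorem integrable_greenFunction_apply {A : C(ℝ, 𝔅 →L[𝕜] 𝔅)} {P : 𝔅 →L[𝕜] 𝔅} {N ν : ℝ}
    (hν : 0 < ν)
    (hs : ∀ t τ : ℝ, τ ≤ t → ‖propagate A P t τ‖ ≤ N * Real.exp (-ν * (t - τ)))
    (hu : ∀ t τ : ℝ, t ≤ τ → ‖propagate A (1 - P) t τ‖ ≤ N * Real.exp (-ν * (τ - t)))
    {f : C(ℝ, 𝔅)} {F : ℝ} (hF : ∀ t, ‖f t‖ ≤ F) (t : ℝ) :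
    Integrable (fun τ => greenFunction A P (1 - P) t τ (f τ)) ∧
      ‖∫ τ, greenFunction A P (1 - P) t τ (f τ)‖
        ≤ ∫ τ, N * Real.exp (-ν * |τ|) * F := by
  have hb : ∀ τ, ‖greenFunction A P (1 - P) t τ (f τ)‖ ≤ N * Real.exp (-ν * |t - τ|) * F :=
    fun τ => ContinuousLinearMap.le_of_opNorm_le_of_le _ (norm_greenFunction_le hs hu t τ) (hF τ)
  have hi : Integrable fun τ : ℝ => N * Real.exp (-ν * |τ|) * F :=
    ((integrable_exp_neg_mul_abs hν).const_mul N).mul_const F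
  have hi' := hi.comp_sub_left t
  refine ⟨hi'.mono' ?_ (ae_of_all _ hb), ?_⟩
  · have e : (fun τ => greenFunction A P (1 - P) t τ (f τ)) = fun τ =>
        if τ < t then propagate A P t τ (f τ) else -propagate A (1 - P) t τ (f τ) := by
      funext τ
      rw [greenFunction_one_sub]
      split_ifs <;> rfl
    rw [e]
    exact (StronglyMeasurable.ite measurableSet_Iio
      (continuous_propagate_apply A P t f.continuous).stronglyMeasurable
      (continuous_propagate_apply A (1 - P) t f.continuous).neg.stronglyMeasurable
      ).aestronglyMeasurable
  · rw [← integral_sub_left_eq_self (fun τ : ℝ => N * Real.exp (-ν * |τ|) * F) volume t]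
    exact norm_integral_le_of_norm_le hi' (ae_of_all _ hb)

/-- This form can be differentiated by the product rule, without differentiating under an improper
integral. With `y = U⁻¹ f`, moving the jump from `0` to `t` adds the integrals of `P y` and `(1 - P)
y` over `0..t`, which sum to that of `y`. -/
theorem integral_greenFunction_apply {A : C(ℝ, 𝔅 →L[𝕜] 𝔅)} {P : 𝔅 →L[𝕜] 𝔅} {f : C(ℝ, 𝔅)}
    (hi : ∀ t, Integrable fun τ => greenFunction A P (1 - P) t τ (f τ)) (t : ℝ) :
    ∫ τ, greenFunction A P (1 - P) t τ (f τ) = (cauchyOperator A t : 𝔅 →L[𝕜] 𝔅)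
      ((∫ τ, greenFunction A P (1 - P) 0 τ (f τ)) +
        ∫ τ in (0 : ℝ)..t, ((cauchyOperator A τ)⁻¹ : (𝔅 →L[𝕜] 𝔅)ˣ).1 (f τ)) := by
  set y : ℝ → 𝔅 := fun τ => ((cauchyOperator A τ)⁻¹ : (𝔅 →L[𝕜] 𝔅)ˣ).1 (f τ) with hy
  have hyc : Continuous y := (continuous_cauchyOperator_inv A).clm_apply f.continuous
  have hlt : ∀ t, ∀ τ ∈ Set.Iio t, greenFunction A P (1 - P) t τ (f τ)
      = (cauchyOperator A t : 𝔅 →L[𝕜] 𝔅) (P (y τ)) := by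
    intro t τ h
    rw [greenFunction_one_sub, if_pos (Set.mem_Iio.1 h)]
    rfl
  have hge : ∀ t, ∀ τ ∈ Set.Ici t, greenFunction A P (1 - P) t τ (f τ)
      = -(cauchyOperator A t : 𝔅 →L[𝕜] 𝔅) ((1 - P) (y τ)) := by
    intro t τ h
    rw [greenFunction_one_sub, if_neg (Set.mem_Ici.1 h).not_gt]
    rfl
  have hinv : ∀ t x, ((cauchyOperator A t)⁻¹ : (𝔅 →L[𝕜] 𝔅)ˣ).1
      ((cauchyOperator A t : 𝔅 →L[𝕜] 𝔅) x) = x := fun t x => by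
    rw [← mul_apply_eq_comp, Units.inv_mul]
    rfl
  -- Applying `U(t)⁻¹` to the integrable Green integrand strips the factor `U(t)`.
  have hk : ∀ t, IntegrableOn (fun τ => P (y τ)) (Set.Iio t) := fun t => by
    refine ((((cauchyOperator A t)⁻¹ : (𝔅 →L[𝕜] 𝔅)ˣ).1.integrable_comp
      (hi t)).integrableOn).congr_fun (fun τ h => ?_) measurableSet_Iio
    simp only [hlt t τ h, hinv]
  have hl : ∀ t, IntegrableOn (fun τ => (1 - P) (y τ)) (Set.Ici t) := fun t => by
    refine ((((cauchyOperator A t)⁻¹ : (𝔅 →L[𝕜] 𝔅)ˣ).1.integrable_comp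
      (hi t)).neg.integrableOn).congr_fun (fun τ h => ?_) measurableSet_Ici
    simp only [Pi.neg_apply, hge t τ h, map_neg, hinv, neg_neg]
  have hsplit : ∀ t, ∫ τ, greenFunction A P (1 - P) t τ (f τ) = (cauchyOperator A t : 𝔅 →L[𝕜] 𝔅)
      ((∫ τ in Set.Iic t, P (y τ)) - ∫ τ in Set.Ioi t, (1 - P) (y τ)) := fun t => by
    rw [← integral_add_compl (measurableSet_Iio (a := t)) (hi t), Set.compl_Iio,
      setIntegral_congr_fun measurableSet_Iio (hlt t),
      setIntegral_congr_fun measurableSet_Ici (hge t), integral_neg,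
      ContinuousLinearMap.integral_comp_comm _ (hk t),
      ContinuousLinearMap.integral_comp_comm _ (hl t), map_sub, ← sub_eq_add_neg,
      integral_Iic_eq_integral_Iio, integral_Ici_eq_integral_Ioi]
  have hk' : ∀ t, IntegrableOn (fun τ => P (y τ)) (Set.Iic t) := fun t =>
    (integrableOn_Iic_iff_integrableOn_Iio).2 (hk t)
  have hl' : ∀ t, IntegrableOn (fun τ => (1 - P) (y τ)) (Set.Ioi t) := fun t =>
    (hl t).mono_set Set.Ioi_subset_Ici_self
  have h1 := intervalIntegral.integral_Iic_sub_Iic (hk' 0) (hk' t)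
  have h2 := intervalIntegral.integral_interval_add_Ioi (hl' 0) (hl' t)
  have h3 : ∫ τ in (0 : ℝ)..t, y τ
      = (∫ τ in (0 : ℝ)..t, P (y τ)) + ∫ τ in (0 : ℝ)..t, (1 - P) (y τ) := by
    have hP : ∀ S : 𝔅 →L[𝕜] 𝔅, IntervalIntegrable (fun τ => S (y τ)) volume 0 t := fun S =>
      (S.continuous.comp hyc).intervalIntegrable _ _
    rw [← intervalIntegral.integral_add (hP P) (hP (1 - P))]
    congr 1
    funext τ
    simp
  rw [hsplit t, hsplit 0, (cauchyOperator_spec A).1, h3, ← h1, ← h2]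
  congr 1
  simp only [Units.val_one, one_apply_eq_self]
  abel

/-- Under a dichotomy on `ℝ`, a bounded right-hand side has a bounded solution, given by the
Green function. -/
theorem exists_bounded_solution {A : C(ℝ, 𝔅 →L[𝕜] 𝔅)} {P : 𝔅 →L[𝕜] 𝔅} {N ν : ℝ} (hν : 0 < ν)
    (hs : ∀ t τ : ℝ, τ ≤ t → ‖propagate A P t τ‖ ≤ N * Real.exp (-ν * (t - τ)))
    (hu : ∀ t τ : ℝ, t ≤ τ → ‖propagate A (1 - P) t τ‖ ≤ N * Real.exp (-ν * (τ - t)))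
    {f : C(ℝ, 𝔅)} {F : ℝ} (hF : ∀ t, ‖f t‖ ≤ F) :
    ∃ φ : C(ℝ, 𝔅), IsSolution A f φ ∧ (∃ W, ∀ t, ‖φ t‖ ≤ W) ∧
      ∀ t, Integrable (fun τ => greenFunction A P (1 - P) t τ (f τ)) ∧
        φ t = ∫ τ, greenFunction A P (1 - P) t τ (f τ) := by
  have hi := integrable_greenFunction_apply hν hs hu hF
  have hd : ∀ t, HasDerivAt (fun t => ∫ τ, greenFunction A P (1 - P) t τ (f τ))
      (A t (∫ τ, greenFunction A P (1 - P) t τ (f τ)) + f t) t := by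
    intro t
    have hyc : Continuous fun τ => ((cauchyOperator A τ)⁻¹ : (𝔅 →L[𝕜] 𝔅)ˣ).1 (f τ) :=
      (continuous_cauchyOperator_inv A).clm_apply f.continuous
    have h := ((cauchyOperator_spec A).2 t).clm_apply_of_isScalarTower
      ((intervalIntegral.integral_hasDerivAt_right (hyc.intervalIntegrable 0 t)
        hyc.stronglyMeasurable.stronglyMeasurableAtFilter hyc.continuousAt).const_add
        (∫ τ, greenFunction A P (1 - P) 0 τ (f τ)))
    rw [funext (integral_greenFunction_apply fun t => (hi t).1)]
    refine h.congr_deriv ?_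
    rw [← mul_apply_eq_comp _ _ (f t), Units.mul_inv,
      integral_greenFunction_apply (fun t => (hi t).1) t]
    rfl
  exact ⟨⟨_, continuous_iff_continuousAt.2 fun t => (hd t).continuousAt⟩, hd,
    ⟨_, fun t => (hi t).2⟩, fun t => ⟨(hi t).1, rfl⟩⟩

/-! ### Comparison of bounded solutions -/

/-- Under a dichotomy on `ℝ`, the translates of a bounded solution converge whenever those of
the coefficients do. -/
theorem IsSolution.exists_tendsto_shiftMap {A : C(ℝ, 𝔅 →L[𝕜] 𝔅)} {P : 𝔅 →L[𝕜] 𝔅} {N ν : ℝ}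
    (hN : 0 ≤ N) (hν : 0 < ν)
    (hs : ∀ t τ : ℝ, τ ≤ t → ‖propagate A P t τ‖ ≤ N * Real.exp (-ν * (t - τ)))
    (hu : ∀ t τ : ℝ, t ≤ τ → ‖propagate A (1 - P) t τ‖ ≤ N * Real.exp (-ν * (τ - t)))
    {f φ : C(ℝ, 𝔅)} (hφ : IsSolution A f φ) {W : ℝ} (hW : ∀ t, ‖φ t‖ ≤ W) {s : ℕ → ℝ}
    {ψ : C(ℝ, (𝔅 →L[𝕜] 𝔅) × 𝔅)}
    (hψ : Tendsto (fun n => shiftMap (s n) (A.prodMk f)) atTop (𝓝 ψ)) :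
    ∃ φ' : C(ℝ, 𝔅), Tendsto (fun n => shiftMap (s n) φ) atTop (𝓝 φ') := by
  have hW0 : 0 ≤ W := (norm_nonneg _).trans (hW 0)
  refine cauchySeq_tendsto_of_complete
    ((Metric.uniformity_basis_dist.compactConvergenceUniformity).cauchySeq_iff.2 ?_)
  rintro ⟨K, δ⟩ ⟨hK, hδ : 0 < δ⟩
  obtain ⟨T, hT⟩ := hK.isBounded.subset_closedBall 0
  -- `L` is fixed first, to control the boundary term (`2 * W` bounds a difference of two values of
  -- `φ`); `η` may then depend on `L`.
  obtain ⟨L, hL, hLδ⟩ : ∃ L : ℝ, 0 ≤ L ∧ 2 * N * (2 * W * Real.exp (-ν * L)) < δ := by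
    have h := ((tendsto_exp_neg_mul_atTop hν).const_mul (2 * W)).const_mul (2 * N)
    simp only [mul_zero] at h
    exact ((eventually_ge_atTop 0).and (h.eventually_lt_const hδ)).exists
  obtain ⟨η, hη, hηδ⟩ : ∃ η : ℝ, 0 < η ∧
      2 * N * (2 * W * Real.exp (-ν * L) + L * (η * W + η)) < δ := by
    have hc : Continuous fun η : ℝ =>
        2 * N * (2 * W * Real.exp (-ν * L) + L * (η * W + η)) := by fun_prop
    have h := (hc.tendsto 0).mono_left (nhdsWithin_le_nhds (s := Set.Ioi 0))
    simp only [zero_mul, add_zero, mul_zero] at h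
    exact (eventually_mem_nhdsWithin.and (h.eventually_lt_const hLδ)).exists
  -- The radius is `T + L` because the estimate at a point of `[-T, T]` looks a distance `L` to
  -- either side.
  obtain ⟨n₀, hn₀⟩ := (Metric.uniformity_basis_dist.compactConvergenceUniformity).cauchySeq_iff.1
    hψ.cauchySeq (Set.Icc (-(T + L)) (T + L), η) ⟨isCompact_Icc, hη⟩
  refine ⟨n₀, fun m hm n hn x hx => ?_⟩
  have hx' : |x| ≤ T := by simpa using hT hx
  set d : ℝ := s n - s m with hd
  -- Comparing `φ` with its translate by `d` keeps `A` itself as the coefficient; the change of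
  -- coefficients goes into the inhomogeneity. At `τ = x + s m` this is the difference of the two
  -- translates at `x`.
  have hdiff : ∀ t, HasDerivAt (fun τ => φ τ - φ (τ + d))
      (A t (φ t - φ (t + d)) + ((A t - A (t + d)) (φ (t + d)) + (f t - f (t + d)))) t := by
    intro t
    refine ((hφ t).sub ((hφ (t + d)).comp_add_const t d)).congr_deriv ?_
    simp only [map_sub, sub_apply]
    abel
  have hr : Continuous fun t => (A t - A (t + d)) (φ (t + d)) + (f t - f (t + d)) := by
    fun_prop
  have hsmall : ∀ τ ∈ Set.Icc (x + s m - L) (x + s m + L),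
      ‖(A τ - A (τ + d)) (φ (τ + d)) + (f τ - f (τ + d))‖ ≤ η * W + η := by
    intro τ hτ
    have hτ' : τ - s m ∈ Set.Icc (-(T + L)) (T + L) := by
      rw [abs_le] at hx'
      constructor <;> linarith [hτ.1, hτ.2]
    have h := hn₀ m hm n hn (τ - s m) hτ'
    have e1 : τ - s m + s m = τ := by ring
    have e2 : τ - s m + s n = τ + d := by rw [hd]; ring
    simp only [shiftMap, Set.mem_ofPred_eq, ContinuousMap.comp_apply, ContinuousMap.coe_addRight,
      ContinuousMap.prod_eval, e1, e2, dist_eq_norm] at h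
    exact (norm_add_le _ _).trans (add_le_add
      (ContinuousLinearMap.le_of_opNorm_le_of_le _ ((norm_fst_le _).trans h.le) (hW _))
      ((norm_snd_le _).trans h.le))
  have hb := norm_le_of_bounded_of_propagate_le hN hν hs hu hr hdiff
    (W := 2 * W) (fun t => (norm_sub_le _ _).trans (by linarith [hW t, hW (t + d)])) hL hsmall
  have e : x + s m + d = x + s n := by rw [hd]; ring
  rw [e, ← dist_eq_norm] at hb
  exact hb.trans_lt hηδ

/-- Under a dichotomy on `ℝ`, there is at most one bounded solution. -/
theorem IsSolution.eq_of_bounded {A : C(ℝ, 𝔅 →L[𝕜] 𝔅)} {P : 𝔅 →L[𝕜] 𝔅} {N ν : ℝ}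
    (hN : 0 ≤ N) (hν : 0 < ν)
    (hs : ∀ t τ : ℝ, τ ≤ t → ‖propagate A P t τ‖ ≤ N * Real.exp (-ν * (t - τ)))
    (hu : ∀ t τ : ℝ, t ≤ τ → ‖propagate A (1 - P) t τ‖ ≤ N * Real.exp (-ν * (τ - t)))
    {f φ ψ : C(ℝ, 𝔅)} (hφ : IsSolution A f φ) (hψ : IsSolution A f ψ) {W V : ℝ}
    (hW : ∀ t, ‖φ t‖ ≤ W) (hV : ∀ t, ‖ψ t‖ ≤ V) : φ = ψ := by
  ext t
  have hd : ∀ t, HasDerivAt (fun τ => φ τ - ψ τ) (A t (φ t - ψ t) + 0) t := by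
    intro t
    refine ((hφ t).sub (hψ t)).congr_deriv ?_
    rw [map_sub]
    abel
  -- The difference solves the homogeneous equation, so `ε = 0` and `L` may tend to infinity.
  have hle : ∀ L : ℝ, 0 ≤ L → ‖φ t - ψ t‖ ≤ 2 * N * ((W + V) * Real.exp (-ν * L) + L * 0) :=
    fun L hL => norm_le_of_bounded_of_propagate_le hN hν hs hu continuous_const hd
      (fun t => (norm_sub_le _ _).trans (add_le_add (hW t) (hV t))) hL (by simp)
  have hlim := ((tendsto_exp_neg_mul_atTop hν).const_mul (W + V)).const_mul (2 * N)
  simp only [mul_zero, add_zero] at hlim hle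
  exact sub_eq_zero.1 (norm_le_zero_iff.1
    (ge_of_tendsto hlim ((eventually_ge_atTop 0).mono hle)))

end Solutions

/-! ### The remotely compatible solution -/

theorem corollary5p2 {𝕜 : Type*} [RCLike 𝕜] {𝔅 : Type*} [NormedAddCommGroup 𝔅]
    [NormedSpace ℝ 𝔅] [NormedSpace 𝕜 𝔅] [IsScalarTower ℝ 𝕜 𝔅] [CompleteSpace 𝔅]
    (A : C(ℝ, 𝔅 →L[𝕜] 𝔅)) (f : C(ℝ, 𝔅))
    (hLagrange : IsLagrangeStable (A.prodMk f))
    (P Q : 𝔅 →L[𝕜] 𝔅) (hTrichotomy : HasExponentialTrichotomy A P Q)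
    (hDichotomy : HasExponentialDichotomyOn A Set.univ) :
    ∃ φ : C(ℝ, 𝔅),
      IsRemotelyCompatibleSolution A f φ ∧
      (∀ ψ : C(ℝ, 𝔅), IsRemotelyCompatibleSolution A f ψ → ψ = φ) ∧
      ∀ t : ℝ, Integrable (fun τ : ℝ => greenFunction A P Q t τ (f τ)) ∧
        φ t = ∫ τ : ℝ, greenFunction A P Q t τ (f τ) := by
  obtain ⟨rfl, N, ν, hN, hν, hs, hu⟩ := hTrichotomy.exists_bounds_of_dichotomy hDichotomy
  obtain ⟨F, hF⟩ := hLagrange.exists_norm_le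
  obtain ⟨φ, hφ, ⟨W, hW⟩, hG⟩ := exists_bounded_solution hν hs hu (f := f) (F := F)
    fun t => (norm_snd_le (A.prodMk f t)).trans (hF t)
  refine ⟨φ, ⟨hφ, ?_⟩, fun ψ hψ => ?_, hG⟩
  · rintro s (⟨hlim, ξ, hξ⟩ | ⟨hlim, ξ, hξ⟩)
    · exact Or.inl ⟨hlim, hφ.exists_tendsto_shiftMap hN hν hs hu hW hξ⟩
    · exact Or.inr ⟨hlim, hφ.exists_tendsto_shiftMap hN hν hs hu hW hξ⟩
  · obtain ⟨V, hV⟩ := exists_norm_le_of_remoteSeqs_subset hLagrange hψ.2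
    exact hψ.1.eq_of_bounded hN hν hs hu hφ hV hW
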